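/- Let $(\Omega,\mathcal F,(\mathcal F_t)_{t\ge 0},\mathbb P)$ be a filtered probability space whose filtration is right-continuous and such that $\mathcal F_0$ contains all $\mathbb P$-null sets of $\mathcal F$. Let $L=(L_t)_{t\ge 0}$ be a nonnegative real-valued local martingale with càdlàg paths and $L_0=1$. Put $L^*_t:=\sup_{0\le s\le t}L_s$ for $t\ge 0$ and $L^*_\infty:=\lim_{t\to\infty}L^*_t=\sup_{t\ge 0}L_t\in[0,\infty]$. Then $$\mathbb P[L^*_\infty\ge x]\le \frac1x\qquad\text{for all }x\in(1,\infty).$$ Moreover, $\mathbb P[L^*_\infty\ge x]=\frac1x$ holds for all $x\in(1,\infty)$ if and only if $L\in\mathcal M_0$, where $\mathcal M_0$ is the set of nonnegative càdlàg local martingales $L$ with $L_0=1$ such that, almost surely, $L_\infty:=\lim_{t\to\infty}L_t=0$ and the path $t\mapsto L^*_t$ is continuous on $[0,\infty)$. (Properties of paths and of random variables are understood $\mathbb P$-almost surely.) -/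

import Mathlib

open MeasureTheory ProbabilityTheory Filter Topology
open scoped NNReal ENNReal

namespace DoobMaximal

/-- A path on `[0, ∞)` is càdlàg: at every time it is right-continuous and has a finite left limit
(the second condition is void at time `0`, where `𝓝[<] 0 = ⊥`). -/
def IsCadlag (f : ℝ≥0 → ℝ) : Prop :=
  ∀ t : ℝ≥0, ContinuousWithinAt f (Set.Ici t) t ∧ ∃ l : ℝ, Tendsto f (𝓝[<] t) (𝓝 l)

/-- The usual conditions: the filtration is right-continuous and its initial sigma-algebra contains
all null sets of the underlying sigma-algebra. -/
structure UsualConditions {Ω : Type*} [mΩ : MeasurableSpace Ω]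
    (𝓕 : Filtration ℝ≥0 mΩ) (P : Measure Ω) : Prop where
  rightContinuous : 𝓕.IsRightContinuous
  null_measurable : ∀ N : Set Ω, MeasurableSet N → P N = 0 → MeasurableSet[𝓕 0] N

/-- Local martingales: adapted processes with (almost surely) càdlàg paths that are
martingales when stopped along some sequence of stopping times increasing to infinity. -/
structure IsLocalMartingale {Ω : Type*} [mΩ : MeasurableSpace Ω]
    (L : ℝ≥0 → Ω → ℝ) (𝓕 : Filtration ℝ≥0 mΩ) (P : Measure Ω) : Prop where
  adapted : StronglyAdapted 𝓕 L
  cadlag : ∀ᵐ ω ∂P, IsCadlag (fun t => L t ω)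
  localized : Locally (fun M => Martingale M 𝓕 P) 𝓕 L P

/-- The running supremum `L*_t = sup_{0 ≤ s ≤ t} L_s`, as an extended real number. -/
noncomputable def runningSup {Ω : Type*} (L : ℝ≥0 → Ω → ℝ) (t : ℝ≥0) (ω : Ω) : EReal :=
  ⨆ s ∈ Set.Icc 0 t, (L s ω : EReal)

/-- The terminal value `L*_∞` of the running supremum: as `L*` is nondecreasing in time, its limit
at infinity is its supremum. -/
noncomputable def terminalSup {Ω : Type*} (L : ℝ≥0 → Ω → ℝ) (ω : Ω) : EReal :=
  ⨆ t : ℝ≥0, runningSup L t ω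

/-- The class `𝓜₀` of nonnegative local martingales that start at `1`, vanish at infinity and have
a continuous running supremum (path properties are understood almost surely). -/
structure MemM0 {Ω : Type*} [mΩ : MeasurableSpace Ω]
    (L : ℝ≥0 → Ω → ℝ) (𝓕 : Filtration ℝ≥0 mΩ) (P : Measure Ω) : Prop where
  isLocalMartingale : IsLocalMartingale L 𝓕 P
  nonneg : ∀ᵐ ω ∂P, ∀ t, 0 ≤ L t ω
  initial : ∀ᵐ ω ∂P, L 0 ω = 1
  terminal : ∀ᵐ ω ∂P, Tendsto (fun t => L t ω) atTop (𝓝 0)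
  continuous_runningSup : ∀ᵐ ω ∂P, Continuous (fun t => runningSup L t ω)

end DoobMaximal

namespace DoobMaximal

/-! Let τ be the first time at which `L` exceeds `y`. Optional stopping for the localized
martingales and Fatou bound the expectation of `stoppedLiminf` at τ by 1
(`lintegral_liminf_localized_le`). Right-continuity gives L_τ ≥ y where τ is finite, hence y P(τ <
∞) ≤ 1. Since τ < ∞ means L*_∞ > y, letting y increase to x gives the inequality.

If equality holds at all levels, nothing is lost in this estimate: the lower limit is y where τ is
finite and 0 elsewhere (`stoppedLiminf_passageTime_ae_eq`). The first fact, at all rational levels,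
forbids jumps of `L` to a new maximum, so L* is continuous. As L*_∞ is finite, the second shows that
`L` comes arbitrarily close to 0; the maximal inequality restarted at the first time below δ then
makes a return above ε unlikely, so `L` tends to 0 (`ae_tendsto_zero`).

Conversely, a continuous L* means no overshoot, so `L` stopped at τ is bounded by x. Dominated
convergence replaces Fatou and gives x P(τ < ∞) = 1 (`mul_measureReal_passageTime_eq`). -/

/-- Discretization from above, on the grid of mesh `1 / (n + 1)`, of a time bounded by `N`. -/
noncomputable def discretize (N : ℝ≥0) (n : ℕ) (t : ℝ≥0) : ℝ≥0 :=
  min N ((⌊(n + 1 : ℝ≥0) * t⌋₊ + 1) / (n + 1))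

lemma discretize_le (N : ℝ≥0) (n : ℕ) (t : ℝ≥0) : discretize N n t ≤ N := min_le_left _ _

lemma le_discretize {N : ℝ≥0} (n : ℕ) {t : ℝ≥0} (ht : t ≤ N) : t ≤ discretize N n t := by
  refine le_min ht ?_
  rw [le_div_iff₀ (by positivity), mul_comm]
  exact (Nat.lt_floor_add_one _).le

lemma discretize_le_add (N : ℝ≥0) (n : ℕ) (t : ℝ≥0) :
    discretize N n t ≤ t + 1 / (n + 1) := by
  refine (min_le_right _ _).trans ?_
  rw [div_le_iff₀ (by positivity), add_mul t, div_mul_cancel₀ _ (by positivity), mul_comm t]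
  gcongr
  exact Nat.floor_le zero_le

/-- Convergence is from the right, so right-continuity of paths is enough to pass to the limit. -/
lemma tendsto_discretize {N t : ℝ≥0} (ht : t ≤ N) :
    Tendsto (fun n => discretize N n t) atTop (𝓝[≥] t) := by
  refine tendsto_nhdsWithin_iff.2 ⟨?_, .of_forall fun n => le_discretize n ht⟩
  refine tendsto_of_tendsto_of_tendsto_of_le_of_le tendsto_const_nhds ?_
    (fun n => le_discretize n ht) (fun n => discretize_le_add N n t)
  simpa using tendsto_const_nhds.add (tendsto_one_div_add_atTop_nhds_zero_nat (𝕜 := ℝ≥0))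

lemma countable_range_discretize (N : ℝ≥0) (n : ℕ) : (Set.range (discretize N n)).Countable := by
  refine (Set.countable_range
    (fun k : ℕ => min N (((k : ℝ≥0) + 1) / (n + 1)))).mono ?_
  rintro _ ⟨t, rfl⟩
  exact ⟨_, rfl⟩

/-! ### Optional stopping at bounded times -/

section OptionalStopping

variable {Ω : Type*} [mΩ : MeasurableSpace Ω] {P : Measure Ω} {𝓕 : Filtration ℝ≥0 mΩ}

lemma isStoppingTime_discretize {τ : Ω → ℝ≥0}
    (hτ : IsStoppingTime 𝓕 fun ω => (τ ω : WithTop ℝ≥0)) (N : ℝ≥0) (n : ℕ) :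
    IsStoppingTime 𝓕 fun ω => (discretize N n (τ ω) : WithTop ℝ≥0) := by
  intro i
  by_cases hi : N ≤ i
  · have huniv : {ω | (discretize N n (τ ω) : WithTop ℝ≥0) ≤ i} = Set.univ :=
      Set.eq_univ_of_forall fun ω => WithTop.coe_le_coe.2 ((discretize_le N n (τ ω)).trans hi)
    rw [huniv]
    exact MeasurableSet.univ
  -- For i < N the event is that τ lies strictly below the last grid point not exceeding i, because
  -- the discretization moves to the next grid point.
  · have hle : (⌊(n + 1 : ℝ≥0) * i⌋₊ : ℝ≥0) / (n + 1) ≤ i := by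
      rw [div_le_iff₀ (by positivity), mul_comm i]
      exact Nat.floor_le zero_le
    convert! 𝓕.mono hle _ (hτ.measurableSet_lt ((⌊(n + 1 : ℝ≥0) * i⌋₊ : ℝ≥0) / (n + 1))) using 1
    ext ω
    simp only [Set.mem_ofPred_eq, WithTop.coe_le_coe, WithTop.coe_lt_coe, discretize, min_le_iff,
      hi, false_or]
    rw [div_le_iff₀ (by positivity), lt_div_iff₀ (by positivity), mul_comm i, mul_comm (τ ω),
      ← Nat.floor_lt zero_le, ← Nat.cast_add_one, ← Nat.le_floor_iff zero_le, Nat.add_one_le_iff]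

/-- Optional stopping in continuous time: a right-continuous martingale, evaluated at a bounded
stopping time, keeps its expectation. -/
theorem integral_stopped [IsFiniteMeasure P] {M : ℝ≥0 → Ω → ℝ} (hM : Martingale M 𝓕 P)
    (hrc : ∀ᵐ ω ∂P, ∀ t, ContinuousWithinAt (fun s => M s ω) (Set.Ici t) t)
    {τ : Ω → ℝ≥0} (hτ : IsStoppingTime 𝓕 fun ω => (τ ω : WithTop ℝ≥0)) {N : ℝ≥0}
    (hN : ∀ ω, τ ω ≤ N) :
    Integrable (fun ω => M (τ ω) ω) P ∧ ∫ ω, M (τ ω) ω ∂P = ∫ ω, M 0 ω ∂P := by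
  have hst := isStoppingTime_discretize hτ N
  have hbd : ∀ n ω, (discretize N n (τ ω) : WithTop ℝ≥0) ≤ N := fun n ω =>
    WithTop.coe_le_coe.2 (discretize_le N n (τ ω))
  have hle : ∀ n, (hst n).measurableSpace ≤ mΩ := fun n => (hst n).measurableSpace_le
  -- Countable range permits discrete optional sampling. All the values are conditional expectations
  -- of the single variable `M N`, hence uniformly integrable.
  have hae : ∀ n, (fun ω => M (discretize N n (τ ω)) ω) =ᵐ[P]
      P[M N | (hst n).measurableSpace] := fun n => by
    refine hM.stoppedValue_ae_eq_condExp_of_le_const_of_countable_range (hst n) (hbd n) ?_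
    refine ((countable_range_discretize N n).image WithTop.some).mono ?_
    rintro _ ⟨ω, rfl⟩
    exact ⟨_, ⟨_, rfl⟩, rfl⟩
  have hui : UniformIntegrable (fun n ω => M (discretize N n (τ ω)) ω) 1 P :=
    ((hM.integrable N).uniformIntegrable_condExp hle).ae_eq fun n => (hae n).symm
  have hlim : ∀ᵐ ω ∂P, Tendsto (fun n => M (discretize N n (τ ω)) ω) atTop (𝓝 (M (τ ω) ω)) := by
    filter_upwards [hrc] with ω hω
    exact (hω (τ ω)).tendsto.comp (tendsto_discretize (hN ω))
  have hint : Integrable (fun ω => M (τ ω) ω) P := hui.integrable_of_ae_tendsto hlim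
  refine ⟨hint, ?_⟩
  have hL1 := tendsto_Lp_finite_of_tendsto_ae le_rfl ENNReal.one_ne_top hui.1
    (memLp_one_iff_integrable.2 hint) hui.2.1 hlim
  have h1 := tendsto_integral_of_L1' _ hint.aestronglyMeasurable
    (.of_forall fun n => memLp_one_iff_integrable.1 (hui.memLp n)) hL1
  have h2 : ∀ n, ∫ ω, M (discretize N n (τ ω)) ω ∂P = ∫ ω, M 0 ω ∂P := fun n => by
    rw [integral_congr_ae (hae n), integral_condExp (hle n), ← setIntegral_univ,
      ← setIntegral_univ (f := M 0)]
    exact (hM.setIntegral_eq zero_le MeasurableSet.univ).symm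
  simp only [h2] at h1
  exact tendsto_nhds_unique tendsto_const_nhds h1 |>.symm

end OptionalStopping

/-! ### Localized martingales and the Fatou estimate -/

section Localization

/-- The finite time `min t s`. -/
noncomputable def capped (t : ℝ≥0) (s : WithTop ℝ≥0) : ℝ≥0 := (min (t : WithTop ℝ≥0) s).untopA

lemma coe_capped (t : ℝ≥0) (s : WithTop ℝ≥0) : (capped t s : WithTop ℝ≥0) = min ↑t s := by
  obtain ⟨r, hr⟩ := WithTop.ne_top_iff_exists.1
    ((min_le_left (t : WithTop ℝ≥0) s).trans_lt (WithTop.coe_lt_top t)).ne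
  rw [capped, ← hr]
  rfl

lemma capped_le (t : ℝ≥0) (s : WithTop ℝ≥0) : capped t s ≤ t := by
  rw [← WithTop.coe_le_coe, coe_capped]
  exact min_le_left _ _

@[simp]
lemma capped_top (t : ℝ≥0) : capped t ⊤ = t := by
  rw [← WithTop.coe_inj, coe_capped, min_eq_left le_top]

@[simp]
lemma capped_coe (t r : ℝ≥0) : capped t r = min t r := by
  rw [← WithTop.coe_inj, coe_capped, WithTop.coe_min]

@[simp]
lemma capped_zero (s : WithTop ℝ≥0) : capped 0 s = 0 := le_antisymm (capped_le 0 s) zero_le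

/-- The process `L` stopped at the `n`-th time of a sequence and set to zero where that time is
zero. -/
noncomputable def localized {Ω : Type*} (L : ℝ≥0 → Ω → ℝ) (σ : ℕ → Ω → WithTop ℝ≥0) (n : ℕ) :
    ℝ≥0 → Ω → ℝ :=
  stoppedProcess (fun i => {ω | ⊥ < σ n ω}.indicator (L i)) (σ n)

variable {Ω : Type*} {L : ℝ≥0 → Ω → ℝ} {σ : ℕ → Ω → WithTop ℝ≥0}

lemma localized_apply (n : ℕ) (t : ℝ≥0) (ω : Ω) [Decidable (⊥ < σ n ω)] :
    localized L σ n t ω = if ⊥ < σ n ω then L (capped t (σ n ω)) ω else 0 := by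
  simp only [localized, stoppedProcess, capped, Set.indicator_apply, Set.mem_ofPred_eq]

lemma localized_nonneg {ω : Ω} (h : ∀ t, 0 ≤ L t ω) (n : ℕ) (t : ℝ≥0) :
    0 ≤ localized L σ n t ω := by
  classical
  rw [localized_apply]
  split_ifs <;> simp [h]

lemma localized_le {ω : Ω} {c : ℝ} (hc : 0 ≤ c) {n : ℕ} {t : ℝ≥0}
    (h : L (capped t (σ n ω)) ω ≤ c) : localized L σ n t ω ≤ c := by
  classical
  rw [localized_apply]
  split_ifs <;> assumption

lemma continuousWithinAt_capped {f : ℝ≥0 → ℝ}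
    (hf : ∀ t, ContinuousWithinAt f (Set.Ici t) t) (s : WithTop ℝ≥0) (t : ℝ≥0) :
    ContinuousWithinAt (fun u => f (capped u s)) (Set.Ici t) t := by
  induction s with
  | top => simpa using hf t
  | coe r =>
    simp only [capped_coe]
    refine (hf (min t r)).comp (f := fun u => min u r) ?_ fun u hu => ?_
    · exact (continuous_id.min continuous_const).continuousWithinAt
    · exact min_le_min_right r hu

lemma continuousWithinAt_localized {ω : Ω}
    (h : ∀ t, ContinuousWithinAt (fun s => L s ω) (Set.Ici t) t) (n : ℕ) (t : ℝ≥0) :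
    ContinuousWithinAt (fun s => localized L σ n s ω) (Set.Ici t) t := by
  classical
  simp only [localized_apply]
  split_ifs
  · exact continuousWithinAt_capped h _ t
  · exact continuousWithinAt_const

lemma eventually_localized_eq {ω : Ω} (hσ : Tendsto (σ · ω) atTop (𝓝 ⊤)) (s : ℕ → ℝ≥0) :
    ∀ᶠ n in atTop, localized L σ n (s n) ω = L (capped (s n) (σ n ω)) ω := by
  classical
  filter_upwards [(WithTop.tendsto_nhds_top_iff _).1 hσ 0] with n hn
  rw [localized_apply, if_pos (bot_le.trans_lt hn)]

lemma eventually_localized_eq_of_coe {ω : Ω} (hσ : Tendsto (σ · ω) atTop (𝓝 ⊤)) (r : ℝ≥0) :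
    ∀ᶠ n : ℕ in atTop, localized L σ n (capped n r) ω = L r ω := by
  filter_upwards [eventually_localized_eq hσ fun n => capped n r,
    (WithTop.tendsto_nhds_top_iff _).1 hσ r, tendsto_natCast_atTop_atTop.eventually_ge_atTop r]
    with n h1 h2 h3
  rw [h1, capped_coe, min_eq_right h3]
  congr 1
  rw [← WithTop.coe_inj, coe_capped, min_eq_left h2.le]

lemma tendsto_capped_localizing {ω : Ω} (hσ : Tendsto (σ · ω) atTop (𝓝 ⊤)) :
    Tendsto (fun n : ℕ => capped n (σ n ω)) atTop atTop := by
  refine tendsto_atTop.2 fun r => ?_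
  filter_upwards [(WithTop.tendsto_nhds_top_iff _).1 hσ r,
    tendsto_natCast_atTop_atTop.eventually_ge_atTop r] with n h2 h3
  rw [← WithTop.coe_le_coe, coe_capped]
  exact le_min (WithTop.coe_le_coe.2 h3) h2.le

variable [mΩ : MeasurableSpace Ω] {P : Measure Ω} {𝓕 : Filtration ℝ≥0 mΩ}

lemma isStoppingTime_capped {τ : Ω → WithTop ℝ≥0} (hτ : IsStoppingTime 𝓕 τ) (t : ℝ≥0) :
    IsStoppingTime 𝓕 fun ω => (capped t (τ ω) : WithTop ℝ≥0) := by
  simp only [coe_capped]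
  simpa only [min_comm] using hτ.min_const t

/-- Optional stopping for the localized martingales. -/
lemma integral_localized [IsFiniteMeasure P]
    (hrc : ∀ᵐ ω ∂P, ∀ t, ContinuousWithinAt (fun s => L s ω) (Set.Ici t) t)
    (hM : ∀ n, Martingale (localized L σ n) 𝓕 P) {τ : Ω → WithTop ℝ≥0}
    (hτ : IsStoppingTime 𝓕 τ) (n : ℕ) (N : ℝ≥0) :
    Integrable (fun ω => localized L σ n (capped N (τ ω)) ω) P ∧
      ∫ ω, localized L σ n (capped N (τ ω)) ω ∂P = ∫ ω, localized L σ n 0 ω ∂P := by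
  refine integral_stopped (hM n) ?_ (isStoppingTime_capped hτ N) (fun ω => capped_le N _)
  filter_upwards [hrc] with ω hω
  exact continuousWithinAt_localized hω n

/-- Beyond the stopping time `ρ`, where `L` is at most `c`, the mass of `L` stopped at a later
time `τ` is at most `c`. -/
theorem lintegral_liminf_localized_le [IsProbabilityMeasure P]
    (hrc : ∀ᵐ ω ∂P, ∀ t, ContinuousWithinAt (fun s => L s ω) (Set.Ici t) t)
    (hnn : ∀ᵐ ω ∂P, ∀ t, 0 ≤ L t ω)
    (hσ : IsLocalizingSequence 𝓕 σ P) (hM : ∀ n, Martingale (localized L σ n) 𝓕 P)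
    {ρ τ : Ω → WithTop ℝ≥0} (hρ : IsStoppingTime 𝓕 ρ) (hτ : IsStoppingTime 𝓕 τ) (hρτ : ρ ≤ τ)
    {c : ℝ} (hc : 0 ≤ c) (hρc : ∀ᵐ ω ∂P, ∀ r : ℝ≥0, ρ ω = r → L r ω ≤ c) :
    ∫⁻ ω in {ω | ρ ω < ⊤}, liminf (fun n : ℕ =>
      ENNReal.ofReal (localized L σ n (capped n (τ ω)) ω)) atTop ∂P ≤ ENNReal.ofReal c := by
  set X : ℕ → Ω → ℝ := fun n ω => localized L σ n (capped n (τ ω)) ω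
  set Y : ℕ → Ω → ℝ := fun n ω => localized L σ n (capped n (ρ ω)) ω
  set A : ℕ → Set Ω := fun n => {ω | ρ ω ≤ min ((n : ℝ≥0) : WithTop ℝ≥0) (σ n ω)}
  have hA : ∀ n, MeasurableSet (A n) := fun n =>
    measurableSet_le hρ.measurable'
      (measurable_const.min ((hσ.isStoppingTime n).measurable'))
  have hX := fun n : ℕ => integral_localized hrc hM hτ n n
  have hY := fun n : ℕ => integral_localized hrc hM hρ n n
  -- Off `A n` both processes have already been frozen at min(n, σ_n), before ρ and τ.
  have hoff : ∀ n, ∫ ω in (A n)ᶜ, X n ω ∂P = ∫ ω in (A n)ᶜ, Y n ω ∂P := fun n => by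
    refine setIntegral_congr_fun (hA n).compl fun ω hω => ?_
    have hlt : min ((n : ℝ≥0) : WithTop ℝ≥0) (σ n ω) < ρ ω := not_le.1 hω
    have key : ∀ s : WithTop ℝ≥0, ρ ω ≤ s →
        capped (capped n s) (σ n ω) = capped n (σ n ω) := fun s hs => by
      rw [← WithTop.coe_inj, coe_capped, coe_capped, coe_capped, min_right_comm,
        min_eq_left (hlt.le.trans hs)]
    classical
    simp only [X, Y, localized_apply, key _ le_rfl, key _ (hρτ ω)]
  -- `X n` and `Y n` have the same mean and agree off `A n`, so their integrals over `A n` agree;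
  -- there `Y n` is L_ρ or 0.
  have hon : ∀ n, ∫ ω in A n, X n ω ∂P ≤ c := fun n => by
    have h1 := integral_add_compl (hA n) (hX n).1
    have h2 := integral_add_compl (hA n) (hY n).1
    have h3 : ∫ ω in A n, Y n ω ∂P ≤ ∫ ω in A n, c ∂P := by
      refine setIntegral_mono_on_ae (hY n).1.integrableOn (integrable_const c).integrableOn
        (hA n) ?_
      filter_upwards [hρc] with ω hω hωA
      have hωA' : ρ ω ≤ min ((n : ℝ≥0) : WithTop ℝ≥0) (σ n ω) := hωA
      refine localized_le hc (hω _ ?_)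
      rw [coe_capped, coe_capped, min_right_comm, min_eq_right hωA']
    have h4 : ∫ ω in A n, c ∂P ≤ c := by
      rw [setIntegral_const, smul_eq_mul]
      exact mul_le_of_le_one_left hc measureReal_le_one
    have h5 := (hX n).2
    have h6 := (hY n).2
    have h7 := hoff n
    simp only [X, Y] at *
    linarith
  have hlint : ∀ n, ∫⁻ ω, (A n).indicator (fun ω => ENNReal.ofReal (X n ω)) ω ∂P ≤
      ENNReal.ofReal c := fun n => by
    rw [lintegral_indicator (hA n), ← ofReal_integral_eq_lintegral_ofReal (hX n).1.integrableOn]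
    · exact ENNReal.ofReal_le_ofReal (hon n)
    · filter_upwards [ae_restrict_of_ae hnn] with ω hω
      exact localized_nonneg hω _ _
  calc ∫⁻ ω in {ω | ρ ω < ⊤}, liminf (fun n => ENNReal.ofReal (X n ω)) atTop ∂P
      = ∫⁻ ω, {ω | ρ ω < ⊤}.indicator
          (fun ω => liminf (fun n => ENNReal.ofReal (X n ω)) atTop) ω ∂P :=
        (lintegral_indicator (measurableSet_lt hρ.measurable' measurable_const) _).symm
    _ ≤ ∫⁻ ω, liminf (fun n => (A n).indicator (fun ω => ENNReal.ofReal (X n ω)) ω) atTop ∂P := by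
        refine lintegral_mono_ae ?_
        filter_upwards [hσ.tendsto_top] with ω hω
        refine Set.indicator_apply_le' (fun hfin => ?_) fun _ => zero_le
        refine (liminf_congr ?_).le
        obtain ⟨r, hr⟩ := WithTop.ne_top_iff_exists.1 (show ρ ω < ⊤ from hfin).ne
        filter_upwards [(WithTop.tendsto_nhds_top_iff _).1 hω r,
          tendsto_natCast_atTop_atTop.eventually_ge_atTop r] with n h1 h2
        have hmem : ω ∈ A n := by
          change ρ ω ≤ _
          rw [← hr]
          exact le_min (WithTop.coe_le_coe.2 h2) h1.le
        rw [Set.indicator_of_mem hmem]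
    _ ≤ liminf (fun n => ∫⁻ ω, (A n).indicator (fun ω => ENNReal.ofReal (X n ω)) ω ∂P) atTop :=
        lintegral_liminf_le' fun n =>
          ((hX n).1.aestronglyMeasurable.aemeasurable.ennreal_ofReal).indicator (hA n)
    _ ≤ ENNReal.ofReal c := by
        refine (liminf_le_liminf (.of_forall hlint)).trans ?_
        simp

end Localization

/-! ### Entry times into open sets -/

section EntryTime

variable {Ω : Type*}

/-- The first time, along a dense sequence, at which `L` is in `U` at or after the time `ρ`. -/
noncomputable def entryTime (L : ℝ≥0 → Ω → ℝ) (U : Set ℝ) (ρ : Ω → WithTop ℝ≥0) (ω : Ω) :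
    WithTop ℝ≥0 :=
  ⨅ (n : ℕ) (_ : ρ ω ≤ TopologicalSpace.denseSeq ℝ≥0 n ∧
      L (TopologicalSpace.denseSeq ℝ≥0 n) ω ∈ U),
    (TopologicalSpace.denseSeq ℝ≥0 n : WithTop ℝ≥0)

variable {L : ℝ≥0 → Ω → ℝ} {U : Set ℝ} {ρ : Ω → WithTop ℝ≥0} {ω : Ω}

lemma entryTime_lt_iff {s : WithTop ℝ≥0} :
    entryTime L U ρ ω < s ↔ ∃ n, (ρ ω ≤ TopologicalSpace.denseSeq ℝ≥0 n ∧
      L (TopologicalSpace.denseSeq ℝ≥0 n) ω ∈ U) ∧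
        (TopologicalSpace.denseSeq ℝ≥0 n : WithTop ℝ≥0) < s := by
  simp only [entryTime, iInf_lt_iff, exists_prop]

lemma le_entryTime : ρ ω ≤ entryTime L U ρ ω :=
  le_iInf fun _ => le_iInf fun h => h.1

lemma exists_mem_of_entryTime_lt_top (h : entryTime L U ρ ω < ⊤) :
    ∃ t : ℝ≥0, ρ ω ≤ t ∧ L t ω ∈ U := by
  obtain ⟨n, hn, -⟩ := entryTime_lt_iff.1 h
  exact ⟨_, hn⟩

/-- Right-continuity keeps `L` in `U` on some interval [t, w), which contains dense times
arbitrarily close to t. -/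
lemma entryTime_le (hrc : ∀ t, ContinuousWithinAt (fun s => L s ω) (Set.Ici t) t)
    (hU : IsOpen U) {t : ℝ≥0} (hρ : ρ ω ≤ t) (ht : L t ω ∈ U) : entryTime L U ρ ω ≤ t := by
  refine le_of_forall_gt fun s hs => ?_
  obtain ⟨v, htv, hv⟩ : ∃ v : ℝ≥0, t < v ∧ (v : WithTop ℝ≥0) ≤ s := by
    induction s with
    | top => exact ⟨t + 1, lt_add_one t, le_top⟩
    | coe r => exact ⟨r, WithTop.coe_lt_coe.1 hs, le_rfl⟩
  obtain ⟨w, hw, hwU⟩ := (mem_nhdsGE_iff_exists_Ico_subset' htv).1 ((hrc t) (hU.mem_nhds ht))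
  obtain ⟨n, hn⟩ := (TopologicalSpace.denseRange_denseSeq ℝ≥0).exists_mem_open
    (isOpen_Ioo (a := t) (b := min v w)) (Set.nonempty_Ioo.2 (lt_min htv hw))
  refine entryTime_lt_iff.2 ⟨n, ⟨hρ.trans (WithTop.coe_le_coe.2 hn.1.le), ?_⟩, ?_⟩
  · exact hwU ⟨hn.1.le, hn.2.trans_le (min_le_right _ _)⟩
  · exact (WithTop.coe_lt_coe.2 (hn.2.trans_le (min_le_left _ _))).trans_le hv

/-- Dense times with values in `U` accumulate at r from the right or include r itself. Only the
closure is reached, and overshoot of a level remains possible. -/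
lemma mem_closure_of_entryTime_eq
    (hrc : ∀ t, ContinuousWithinAt (fun s => L s ω) (Set.Ici t) t)
    {r : ℝ≥0} (h : entryTime L U ρ ω = r) : L r ω ∈ closure U := by
  by_contra hr
  obtain ⟨w, hw, hwU⟩ := (mem_nhdsGE_iff_exists_Ico_subset' (lt_add_one r)).1
    ((hrc r) (isClosed_closure.isOpen_compl.mem_nhds hr))
  obtain ⟨n, hn, hlt⟩ := entryTime_lt_iff.1 (h.trans_lt (WithTop.coe_lt_coe.2 hw))
  have hle : r ≤ TopologicalSpace.denseSeq ℝ≥0 n := by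
    rw [← WithTop.coe_le_coe, ← h]
    exact iInf₂_le n hn
  exact hwU ⟨hle, WithTop.coe_lt_coe.1 hlt⟩ (subset_closure hn.2)

/-- The first time at which `L` exceeds the level `y`. -/
noncomputable def passageTime (L : ℝ≥0 → Ω → ℝ) (y : ℝ) : Ω → WithTop ℝ≥0 :=
  entryTime L (Set.Ioi y) fun _ => ((0 : ℝ≥0) : WithTop ℝ≥0)

lemma passageTime_le (hrc : ∀ t, ContinuousWithinAt (fun s => L s ω) (Set.Ici t) t)
    {y : ℝ} {t : ℝ≥0} (ht : y < L t ω) : passageTime L y ω ≤ t :=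
  entryTime_le hrc isOpen_Ioi (WithTop.coe_le_coe.2 zero_le) ht

lemma le_of_passageTime_eq
    (hrc : ∀ t, ContinuousWithinAt (fun s => L s ω) (Set.Ici t) t) {y : ℝ} {r : ℝ≥0}
    (h : passageTime L y ω = r) : y ≤ L r ω := by
  simpa only [closure_Ioi, Set.mem_Ici] using mem_closure_of_entryTime_eq hrc h

/-- The event of entry strictly before i is a countable union over dense times; right-continuity of
the filtration makes strict inequalities sufficient. -/
lemma isStoppingTime_entryTime [mΩ : MeasurableSpace Ω] {𝓕 : Filtration ℝ≥0 mΩ}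
    [𝓕.IsRightContinuous] (hL : StronglyAdapted 𝓕 L) (hU : MeasurableSet U)
    (hρ : IsStoppingTime 𝓕 ρ) : IsStoppingTime 𝓕 (entryTime L U ρ) := by
  refine isStoppingTime_of_measurableSet_lt_of_isRightContinuous fun i => ?_
  simp only [entryTime_lt_iff, Set.ofPred_exists]
  refine MeasurableSet.iUnion fun n => ?_
  by_cases hn : TopologicalSpace.denseSeq ℝ≥0 n < i
  · simp only [WithTop.coe_lt_coe, hn, and_true]
    refine 𝓕.mono hn.le _ ((hρ _).inter ?_)
    exact (hL _).measurable hU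
  · simp only [WithTop.coe_lt_coe, hn, and_false]
    exact MeasurableSet.const _

end EntryTime

/-! ### Running supremum and passage over levels -/

section RunningSup

variable {Ω : Type*} {L : ℝ≥0 → Ω → ℝ} {ω : Ω}

lemma le_runningSup {s t : ℝ≥0} (h : s ≤ t) : (L s ω : EReal) ≤ runningSup L t ω :=
  le_iSup₂_of_le s ⟨zero_le, h⟩ le_rfl

lemma runningSup_le {t : ℝ≥0} {a : EReal} (h : ∀ s ≤ t, (L s ω : EReal) ≤ a) :
    runningSup L t ω ≤ a :=
  iSup₂_le fun s hs => h s hs.2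

lemma runningSup_mono : Monotone fun t => runningSup L t ω :=
  fun _ _ hst => runningSup_le fun _ hu => le_runningSup (hu.trans hst)

lemma lt_terminalSup_iff {a : EReal} : a < terminalSup L ω ↔ ∃ t, a < (L t ω : EReal) := by
  refine ⟨fun h => ?_, fun ⟨t, ht⟩ => ht.trans_le
    ((le_runningSup le_rfl).trans (le_iSup (fun t => runningSup L t ω) t))⟩
  simp only [terminalSup, runningSup, lt_iSup_iff] at h
  obtain ⟨_, s, _, hs⟩ := h
  exact ⟨s, hs⟩

lemma passageTime_lt_top_iff
    (hrc : ∀ t, ContinuousWithinAt (fun s => L s ω) (Set.Ici t) t) {y : ℝ} :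
    passageTime L y ω < ⊤ ↔ (y : EReal) < terminalSup L ω := by
  rw [lt_terminalSup_iff]
  refine ⟨fun h => ?_, fun ⟨t, ht⟩ => ?_⟩
  · obtain ⟨t, -, ht⟩ := exists_mem_of_entryTime_lt_top h
    exact ⟨t, EReal.coe_lt_coe_iff.2 ht⟩
  · exact (passageTime_le hrc (EReal.coe_lt_coe_iff.1 ht)).trans_lt (WithTop.coe_lt_top t)

/-- If a right-continuous path cannot jump over the levels of a dense set, its running supremum is
continuous. -/
lemma continuous_runningSup (hrc : ∀ t, ContinuousWithinAt (fun s => L s ω) (Set.Ici t) t)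
    (hlevel : ∀ a b, L 0 ω ≤ a → a < b → ∃ y ∈ Set.Ioo a b, ∀ t : ℝ≥0,
      (∀ u < t, L u ω ≤ y) → L t ω ≤ y) :
    Continuous fun t => runningSup L t ω := by
  refine continuous_iff_continuousAt.2 fun t => tendsto_order.2 ⟨fun a ha => ?_, fun a ha => ?_⟩
  · rcases eq_zero_or_pos t with rfl | ht
    · exact .of_forall fun u => ha.trans_le (runningSup_mono zero_le)
    -- Otherwise the path is at most a before t and above a at t, so it jumps over a level in
    -- between.
    obtain ⟨v, hv, hav⟩ : ∃ v < t, a < runningSup L v ω := by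
      by_contra! hcon
      have hLa : ∀ u < t, (L u ω : EReal) ≤ a := fun u hu => (le_runningSup le_rfl).trans (hcon u hu)
      have hat : a < (L t ω : EReal) := by
        by_contra! hta
        refine ha.not_ge (runningSup_le fun s hs => ?_)
        rcases hs.lt_or_eq with h | rfl
        exacts [hLa s h, hta]
      lift a to ℝ using ⟨hat.ne_top, ((EReal.bot_lt_coe _).trans_le (hLa 0 ht)).ne'⟩
      obtain ⟨y, hy, hyt⟩ := hlevel a (L t ω) (EReal.coe_le_coe_iff.1 (hLa 0 ht))
        (EReal.coe_lt_coe_iff.1 hat)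
      exact hy.2.not_ge (hyt t fun u hu => (EReal.coe_le_coe_iff.1 (hLa u hu)).trans hy.1.le)
    filter_upwards [Ioi_mem_nhds hv] with u hu
    exact hav.trans_le (runningSup_mono (le_of_lt hu))
  · obtain ⟨b, hb, hba⟩ := exists_between ha
    have hcont : ContinuousWithinAt (fun s => (L s ω : EReal)) (Set.Ici t) t :=
      continuous_coe_real_ereal.continuousAt.comp_continuousWithinAt (hrc t)
    obtain ⟨w, hw, hwb⟩ := (mem_nhdsGE_iff_exists_Ico_subset' (lt_add_one t)).1
      (hcont (Iio_mem_nhds ((le_runningSup le_rfl).trans_lt hb)))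
    filter_upwards [Iio_mem_nhds hw] with u hu
    refine (runningSup_le fun s hs => ?_).trans_lt hba
    rcases le_total s t with h | h
    · exact (le_runningSup h).trans hb.le
    · exact (show (L s ω : EReal) < b from hwb ⟨h, hs.trans_lt hu⟩).le

/-- A path whose running supremum is continuous cannot jump over a level. -/
lemma le_of_continuous_runningSup (hc : Continuous fun t => runningSup L t ω) {x : ℝ}
    (h0 : L 0 ω ≤ x) {t : ℝ≥0} (ht : ∀ u < t, L u ω ≤ x) : L t ω ≤ x := by
  rcases eq_zero_or_pos t with rfl | hpos
  · exact h0
  have : (𝓝[<] t).NeBot := nhdsLT_neBot_of_exists_lt ⟨0, hpos⟩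
  have h : runningSup L t ω ≤ (x : EReal) := by
    refine le_of_tendsto (x := 𝓝[<] t) ((hc.tendsto t).mono_left nhdsWithin_le_nhds)
      (eventually_mem_nhdsWithin.mono fun u hu => runningSup_le fun s hs => ?_)
    exact EReal.coe_le_coe_iff.2 (ht s (hs.trans_lt hu))
  exact EReal.coe_le_coe_iff.1 ((le_runningSup le_rfl).trans h)

end RunningSup

/-! ### Value at a possibly infinite stopping time -/

section StoppedLiminf

variable {Ω : Type*}

/-- The lower limit of the localized martingales stopped at `τ`, which is the value of `L` at `τ`
where `τ` is finite. -/
noncomputable def stoppedLiminf (L : ℝ≥0 → Ω → ℝ) (σ : ℕ → Ω → WithTop ℝ≥0)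
    (τ : Ω → WithTop ℝ≥0) (ω : Ω) : ℝ≥0∞ :=
  liminf (fun n : ℕ => ENNReal.ofReal (localized L σ n (capped n (τ ω)) ω)) atTop

variable {L : ℝ≥0 → Ω → ℝ} {σ : ℕ → Ω → WithTop ℝ≥0} {τ : Ω → WithTop ℝ≥0} {ω : Ω}

lemma stoppedLiminf_eq (hσ : Tendsto (σ · ω) atTop (𝓝 ⊤)) {r : ℝ≥0} (h : τ ω = r) :
    stoppedLiminf L σ τ ω = ENNReal.ofReal (L r ω) := by
  rw [stoppedLiminf, h]
  refine (liminf_congr ?_).trans (liminf_const _)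
  filter_upwards [eventually_localized_eq_of_coe hσ r] with n hn
  rw [hn]

lemma exists_lt_of_stoppedLiminf_eq_zero (hσ : Tendsto (σ · ω) atTop (𝓝 ⊤))
    (h : stoppedLiminf L σ τ ω = 0) {δ : ℝ} (hδ : 0 < δ) : ∃ t, L t ω < δ := by
  by_contra! hcon
  have hle : ENNReal.ofReal δ ≤ stoppedLiminf L σ τ ω := by
    refine le_liminf_of_le (by isBoundedDefault) ?_
    filter_upwards [eventually_localized_eq hσ fun n => capped n (τ ω)] with n hn
    rw [hn]
    exact ENNReal.ofReal_le_ofReal (hcon _)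
  rw [h] at hle
  exact (ENNReal.ofReal_pos.2 hδ).not_ge hle

end StoppedLiminf

/-! ### The maximal inequality and its equality case -/

section MaximalInequality

variable {Ω : Type*} [mΩ : MeasurableSpace Ω] {P : Measure Ω} {𝓕 : Filtration ℝ≥0 mΩ}
  {L : ℝ≥0 → Ω → ℝ} {σ : ℕ → Ω → WithTop ℝ≥0}

lemma aemeasurable_stoppedLiminf [IsFiniteMeasure P]
    (hrc : ∀ᵐ ω ∂P, ∀ t, ContinuousWithinAt (fun s => L s ω) (Set.Ici t) t)
    (hM : ∀ n, Martingale (localized L σ n) 𝓕 P) {τ : Ω → WithTop ℝ≥0}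
    (hτ : IsStoppingTime 𝓕 τ) : AEMeasurable (stoppedLiminf L σ τ) P := by
  unfold stoppedLiminf
  simp only [liminf_eq_iSup_iInf_of_nat]
  exact .iSup fun n => .biInf _ (Set.to_countable {i | i ≥ n}) fun i _ =>
    (integral_localized hrc hM hτ i i).1.aestronglyMeasurable.aemeasurable.ennreal_ofReal

lemma indicator_le_stoppedLiminf
    (hrc : ∀ᵐ ω ∂P, ∀ t, ContinuousWithinAt (fun s => L s ω) (Set.Ici t) t)
    (hσ : IsLocalizingSequence 𝓕 σ P) (ρ : Ω → WithTop ℝ≥0) (y : ℝ) :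
    {ω | entryTime L (Set.Ioi y) ρ ω < ⊤}.indicator (fun _ => ENNReal.ofReal y) ≤ᵐ[P]
      stoppedLiminf L σ (entryTime L (Set.Ioi y) ρ) := by
  filter_upwards [hrc, hσ.tendsto_top] with ω hω hσω
  refine Set.indicator_apply_le' (fun hfin => ?_) fun _ => zero_le
  obtain ⟨r, hr⟩ := WithTop.ne_top_iff_exists.1
    (show entryTime L (Set.Ioi y) ρ ω < ⊤ from hfin).ne
  rw [stoppedLiminf_eq hσω hr.symm]
  refine ENNReal.ofReal_le_ofReal ?_
  simpa only [closure_Ioi, Set.mem_Ici] using mem_closure_of_entryTime_eq hω hr.symm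

/-- The maximal inequality after a stopping time at which `L` is at most `c`. -/
theorem mul_measure_entryTime_lt_top_le [IsProbabilityMeasure P] [𝓕.IsRightContinuous]
    (hL : StronglyAdapted 𝓕 L)
    (hrc : ∀ᵐ ω ∂P, ∀ t, ContinuousWithinAt (fun s => L s ω) (Set.Ici t) t)
    (hnn : ∀ᵐ ω ∂P, ∀ t, 0 ≤ L t ω)
    (hσ : IsLocalizingSequence 𝓕 σ P) (hM : ∀ n, Martingale (localized L σ n) 𝓕 P)
    {ρ : Ω → WithTop ℝ≥0} (hρ : IsStoppingTime 𝓕 ρ)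
    {c : ℝ} (hc : 0 ≤ c) (hρc : ∀ᵐ ω ∂P, ∀ r : ℝ≥0, ρ ω = r → L r ω ≤ c) (y : ℝ) :
    ENNReal.ofReal y * P {ω | entryTime L (Set.Ioi y) ρ ω < ⊤} ≤ ENNReal.ofReal c := by
  have hτ := isStoppingTime_entryTime hL (measurableSet_Ioi (a := y)) hρ
  calc ENNReal.ofReal y * P {ω | entryTime L (Set.Ioi y) ρ ω < ⊤}
      = ∫⁻ ω in {ω | ρ ω < ⊤}, {ω | entryTime L (Set.Ioi y) ρ ω < ⊤}.indicator
          (fun _ => ENNReal.ofReal y) ω ∂P := by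
        rw [lintegral_indicator_const (measurableSet_lt hτ.measurable' measurable_const),
          Measure.restrict_apply (measurableSet_lt hτ.measurable' measurable_const),
          Set.inter_eq_self_of_subset_left]
        exact fun ω hω => lt_of_le_of_lt le_entryTime hω
    _ ≤ ∫⁻ ω in {ω | ρ ω < ⊤}, stoppedLiminf L σ (entryTime L (Set.Ioi y) ρ) ω ∂P :=
        lintegral_mono_ae (ae_restrict_of_ae (indicator_le_stoppedLiminf hrc hσ ρ y))
    _ ≤ ENNReal.ofReal c :=
        lintegral_liminf_localized_le hrc hnn hσ hM hρ hτ (fun _ => le_entryTime) hc hρc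

lemma isStoppingTime_passageTime [𝓕.IsRightContinuous] (hL : StronglyAdapted 𝓕 L) (y : ℝ) :
    IsStoppingTime 𝓕 (passageTime L y) :=
  isStoppingTime_entryTime hL measurableSet_Ioi (isStoppingTime_const 𝓕 0)

lemma ofReal_mul_measure_passageTime_le [IsProbabilityMeasure P] [𝓕.IsRightContinuous]
    (hL : StronglyAdapted 𝓕 L)
    (hrc : ∀ᵐ ω ∂P, ∀ t, ContinuousWithinAt (fun s => L s ω) (Set.Ici t) t)
    (hnn : ∀ᵐ ω ∂P, ∀ t, 0 ≤ L t ω) (h0 : ∀ᵐ ω ∂P, L 0 ω = 1)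
    (hσ : IsLocalizingSequence 𝓕 σ P) (hM : ∀ n, Martingale (localized L σ n) 𝓕 P) (y : ℝ) :
    ENNReal.ofReal y * P {ω | passageTime L y ω < ⊤} ≤ 1 := by
  refine (mul_measure_entryTime_lt_top_le hL hrc hnn hσ hM (isStoppingTime_const 𝓕 0)
    zero_le_one ?_ y).trans_eq ENNReal.ofReal_one
  filter_upwards [h0] with ω hω r hr
  rw [← WithTop.coe_inj.1 hr, hω]

lemma mul_measureReal_passageTime_le [IsProbabilityMeasure P] [𝓕.IsRightContinuous]
    (hL : StronglyAdapted 𝓕 L)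
    (hrc : ∀ᵐ ω ∂P, ∀ t, ContinuousWithinAt (fun s => L s ω) (Set.Ici t) t)
    (hnn : ∀ᵐ ω ∂P, ∀ t, 0 ≤ L t ω) (h0 : ∀ᵐ ω ∂P, L 0 ω = 1)
    (hσ : IsLocalizingSequence 𝓕 σ P) (hM : ∀ n, Martingale (localized L σ n) 𝓕 P)
    {y : ℝ} (hy : 0 ≤ y) : y * P.real {ω | passageTime L y ω < ⊤} ≤ 1 := by
  have h := ENNReal.toReal_mono ENNReal.one_ne_top
    (ofReal_mul_measure_passageTime_le hL hrc hnn h0 hσ hM y)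
  rwa [ENNReal.toReal_mul, ENNReal.toReal_ofReal hy, ENNReal.toReal_one] at h

/-- Doob's maximal inequality for nonnegative local martingales starting at one. -/
theorem measure_le_terminalSup_le [IsProbabilityMeasure P] [𝓕.IsRightContinuous]
    (hL : StronglyAdapted 𝓕 L)
    (hrc : ∀ᵐ ω ∂P, ∀ t, ContinuousWithinAt (fun s => L s ω) (Set.Ici t) t)
    (hnn : ∀ᵐ ω ∂P, ∀ t, 0 ≤ L t ω) (h0 : ∀ᵐ ω ∂P, L 0 ω = 1)
    (hσ : IsLocalizingSequence 𝓕 σ P) (hM : ∀ n, Martingale (localized L σ n) 𝓕 P)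
    {x : ℝ} (hx : 0 < x) : P {ω | (x : EReal) ≤ terminalSup L ω} ≤ ENNReal.ofReal (1 / x) := by
  rw [← ofReal_measureReal]
  refine ENNReal.ofReal_le_ofReal ?_
  by_contra! hlt
  have hp : 0 < P.real {ω | (x : EReal) ≤ terminalSup L ω} := (by positivity : 0 < 1 / x).trans hlt
  -- y < x puts the event inside that of passing y, while y > 1/p makes y p > 1.
  obtain ⟨y, hy, hyx⟩ := exists_between ((one_div_lt hx hp).1 hlt)
  have hy0 : 0 < y := (by positivity : 0 < 1 / P.real _).trans hy
  have hle : P.real {ω | (x : EReal) ≤ terminalSup L ω} ≤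
      P.real {ω | passageTime L y ω < ⊤} := by
    refine ENNReal.toReal_mono (measure_ne_top _ _) (measure_mono_ae ?_)
    filter_upwards [hrc] with ω hω hxω
    exact (passageTime_lt_top_iff hω).2 ((EReal.coe_lt_coe_iff.2 hyx).trans_le hxω)
  have h1 := mul_measureReal_passageTime_le hL hrc hnn h0 hσ hM hy0.le
  have h2 := (div_lt_iff₀ hp).1 hy
  nlinarith

/-- If the maximal inequality is an equality, `L` takes exactly the value `y` when it passes the
level `y`, and its lower limit is zero where it never does. -/
theorem stoppedLiminf_passageTime_ae_eq [IsProbabilityMeasure P] [𝓕.IsRightContinuous]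
    (hL : StronglyAdapted 𝓕 L)
    (hrc : ∀ᵐ ω ∂P, ∀ t, ContinuousWithinAt (fun s => L s ω) (Set.Ici t) t)
    (hnn : ∀ᵐ ω ∂P, ∀ t, 0 ≤ L t ω) (h0 : ∀ᵐ ω ∂P, L 0 ω = 1)
    (hσ : IsLocalizingSequence 𝓕 σ P) (hM : ∀ n, Martingale (localized L σ n) 𝓕 P)
    (heq : ∀ x : ℝ, 1 < x → P {ω | (x : EReal) ≤ terminalSup L ω} = ENNReal.ofReal (1 / x))
    {y : ℝ} (hy : 1 < y) :
    {ω | passageTime L y ω < ⊤}.indicator (fun _ => ENNReal.ofReal y) =ᵐ[P]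
      stoppedLiminf L σ (passageTime L y) := by
  have hy0 : 0 < y := one_pos.trans hy
  have hτ := isStoppingTime_passageTime hL y
  have hmeas : MeasurableSet {ω | passageTime L y ω < ⊤} :=
    measurableSet_lt hτ.measurable' measurable_const
  have hint : ∫⁻ ω, {ω | passageTime L y ω < ⊤}.indicator (fun _ => ENNReal.ofReal y) ω ∂P =
      ENNReal.ofReal y * P {ω | passageTime L y ω < ⊤} := lintegral_indicator_const hmeas _
  -- The hypothesis concerns L*_∞ ≥ x, passage means L*_∞ > y: a level 1/q just above y, attained
  -- with probability q, bridges the two.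
  have hge : 1 / y ≤ P.real {ω | passageTime L y ω < ⊤} := by
    by_contra! hlt
    obtain ⟨q, hq, hqy⟩ := exists_between hlt
    have hq0 : 0 < q := measureReal_nonneg.trans_lt hq
    have hyq : y < 1 / q := (lt_one_div hq0 hy0).1 hqy
    refine hq.not_ge ?_
    have h1 : P.real {ω | ((1 / q : ℝ) : EReal) ≤ terminalSup L ω} = q := by
      rw [measureReal_def, heq _ (hy.trans hyq), one_div_one_div, ENNReal.toReal_ofReal hq0.le]
    rw [← h1]
    refine ENNReal.toReal_mono (measure_ne_top _ _) (measure_mono_ae ?_)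
    filter_upwards [hrc] with ω hω hxω
    exact (passageTime_lt_top_iff hω).2 ((EReal.coe_lt_coe_iff.2 hyq).trans_le hxω)
  -- The larger function has integral at most 1, the smaller at least 1.
  refine ae_eq_of_ae_le_of_lintegral_le (indicator_le_stoppedLiminf hrc hσ _ y) ?_
    (aemeasurable_stoppedLiminf hrc hM hτ) ?_
  · rw [hint]
    exact ((ofReal_mul_measure_passageTime_le hL hrc hnn h0 hσ hM y).trans_lt
      ENNReal.one_lt_top).ne
  · have h1 : ∫⁻ ω, stoppedLiminf L σ (passageTime L y) ω ∂P ≤ ENNReal.ofReal 1 := by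
      have h2 := lintegral_liminf_localized_le hrc hnn hσ hM (isStoppingTime_const 𝓕 0) hτ
        (fun _ => le_entryTime) zero_le_one (by
          filter_upwards [h0] with ω hω r hr
          rw [← WithTop.coe_inj.1 hr, hω])
      simpa [stoppedLiminf] using h2
    refine h1.trans ?_
    rw [hint, ← ofReal_measureReal (μ := P) (s := {ω | passageTime L y ω < ⊤}),
      ← ENNReal.ofReal_mul hy0.le]
    refine ENNReal.ofReal_le_ofReal ?_
    rwa [div_le_iff₀' hy0] at hge

/-- A nonnegative local martingale that attains arbitrarily small values tends to zero. -/
theorem ae_tendsto_zero [IsProbabilityMeasure P] [𝓕.IsRightContinuous]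
    (hL : StronglyAdapted 𝓕 L)
    (hrc : ∀ᵐ ω ∂P, ∀ t, ContinuousWithinAt (fun s => L s ω) (Set.Ici t) t)
    (hnn : ∀ᵐ ω ∂P, ∀ t, 0 ≤ L t ω)
    (hσ : IsLocalizingSequence 𝓕 σ P) (hM : ∀ n, Martingale (localized L σ n) 𝓕 P)
    (hsmall : ∀ᵐ ω ∂P, ∀ δ : ℝ, 0 < δ → ∃ t, L t ω < δ) :
    ∀ᵐ ω ∂P, Tendsto (fun t => L t ω) atTop (𝓝 0) := by
  have key : ∀ ε : ℝ, 0 < ε → ∀ᵐ ω ∂P, ∃ s, ∀ t, s ≤ t → L t ω ≤ ε := fun ε hε => by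
    rw [ae_iff]
    push Not
    -- Restart at the first time ρ below δ, where L ≤ δ. A path exceeding ε at arbitrarily late
    -- times does so after ρ.
    have hδ : ∀ δ : ℝ, 0 < δ →
        ENNReal.ofReal ε * P {ω | ∀ s, ∃ t, s ≤ t ∧ ε < L t ω} ≤ ENNReal.ofReal δ := fun δ hδ => by
      set ρ := entryTime L (Set.Iio δ) fun _ => ((0 : ℝ≥0) : WithTop ℝ≥0)
      have hρ : IsStoppingTime 𝓕 ρ :=
        isStoppingTime_entryTime hL measurableSet_Iio (isStoppingTime_const 𝓕 0)
      refine le_trans ?_ (mul_measure_entryTime_lt_top_le hL hrc hnn hσ hM hρ hδ.le ?_ ε)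
      · gcongr 1
        refine measure_mono_ae ?_
        filter_upwards [hrc, hsmall] with ω hω hsω hev
        obtain ⟨t, ht⟩ := hsω δ hδ
        obtain ⟨u, htu, hu⟩ := hev t
        have hρt : ρ ω ≤ t := entryTime_le hω isOpen_Iio (WithTop.coe_le_coe.2 zero_le) ht
        exact (entryTime_le hω isOpen_Ioi (hρt.trans (WithTop.coe_le_coe.2 htu)) hu).trans_lt
          (WithTop.coe_lt_top u)
      · filter_upwards [hrc] with ω hω r hr
        simpa only [closure_Iio, Set.mem_Iic] using mem_closure_of_entryTime_eq hω hr
    have hzero : ENNReal.ofReal ε * P {ω | ∀ s, ∃ t, s ≤ t ∧ ε < L t ω} ≤ ENNReal.ofReal 0 := by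
      have hlim : Tendsto ENNReal.ofReal (𝓝[>] 0) (𝓝 (ENNReal.ofReal 0)) :=
        (ENNReal.continuous_ofReal.tendsto 0).mono_left nhdsWithin_le_nhds
      exact ge_of_tendsto hlim (eventually_mem_nhdsWithin.mono hδ)
    rw [ENNReal.ofReal_zero, nonpos_iff_eq_zero, mul_eq_zero] at hzero
    exact hzero.resolve_left (ENNReal.ofReal_pos.2 hε).ne'
  have hall := ae_all_iff.2 fun k : ℕ => key (1 / (k + 1)) Nat.one_div_pos_of_nat
  filter_upwards [hall, hnn] with ω hω hnnω
  refine tendsto_order.2 ⟨fun a ha => .of_forall fun t => ha.trans_le (hnnω t), fun a ha => ?_⟩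
  obtain ⟨k, hk⟩ := exists_nat_one_div_lt ha
  obtain ⟨s, hs⟩ := hω k
  filter_upwards [eventually_ge_atTop s] with t ht
  exact (hs t ht).trans_lt hk

/-- If the maximal inequality is an equality at all levels, then `L` tends to zero and its running
supremum is continuous. -/
theorem ae_tendsto_and_continuous_of_measure_eq [IsProbabilityMeasure P] [𝓕.IsRightContinuous]
    (hL : StronglyAdapted 𝓕 L)
    (hrc : ∀ᵐ ω ∂P, ∀ t, ContinuousWithinAt (fun s => L s ω) (Set.Ici t) t)
    (hnn : ∀ᵐ ω ∂P, ∀ t, 0 ≤ L t ω) (h0 : ∀ᵐ ω ∂P, L 0 ω = 1)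
    (hσ : IsLocalizingSequence 𝓕 σ P) (hM : ∀ n, Martingale (localized L σ n) 𝓕 P)
    (heq : ∀ x : ℝ, 1 < x → P {ω | (x : EReal) ≤ terminalSup L ω} = ENNReal.ofReal (1 / x)) :
    (∀ᵐ ω ∂P, Tendsto (fun t => L t ω) atTop (𝓝 0)) ∧
      ∀ᵐ ω ∂P, Continuous fun t => runningSup L t ω := by
  have hZ : ∀ᵐ ω ∂P, ∀ y : ℚ, (1 : ℝ) < y →
      {ω | passageTime L (y : ℝ) ω < ⊤}.indicator (fun _ => ENNReal.ofReal (y : ℝ)) ω =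
        stoppedLiminf L σ (passageTime L (y : ℝ)) ω :=
    ae_all_iff.2 fun y => by
      by_cases hy : (1 : ℝ) < y
      · filter_upwards [stoppedLiminf_passageTime_ae_eq hL hrc hnn h0 hσ hM heq hy] with ω hω _
        exact hω
      · exact .of_forall fun ω h => absurd h hy
  -- Almost surely L*_∞ is finite, by the maximal inequality at the levels n + 2, which all exceed
  -- 1.
  have hfinite : ∀ᵐ ω ∂P, ∃ y : ℚ, (1 : ℝ) < y ∧ ¬ passageTime L (y : ℝ) ω < ⊤ := by
    rw [ae_iff]
    push Not
    have hle : ∀ n : ℕ, P {ω | ∀ y : ℚ, (1 : ℝ) < y → passageTime L (y : ℝ) ω < ⊤} ≤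
        ENNReal.ofReal (1 / ((n : ℝ) + 2)) := fun n => by
      refine (measure_mono_ae ?_).trans
        (measure_le_terminalSup_le hL hrc hnn h0 hσ hM (by positivity : (0 : ℝ) < n + 2))
      filter_upwards [hrc] with ω hω h
      have hn := (passageTime_lt_top_iff hω).1
        (h (n + 2) (by push_cast; linarith [n.cast_nonneg (α := ℝ)]))
      push_cast at hn
      exact_mod_cast hn.le
    have hlim : Tendsto (fun n : ℕ => ENNReal.ofReal (1 / ((n : ℝ) + 2))) atTop (𝓝 0) := by
      rw [← ENNReal.ofReal_zero]
      refine (ENNReal.continuous_ofReal.tendsto 0).comp ?_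
      exact tendsto_const_nhds.div_atTop
        (tendsto_atTop_add_const_right _ _ tendsto_natCast_atTop_atTop)
    exact nonpos_iff_eq_zero.1 (ge_of_tendsto' hlim hle)
  refine ⟨ae_tendsto_zero hL hrc hnn hσ hM ?_, ?_⟩
  · filter_upwards [hZ, hfinite, hσ.tendsto_top] with ω hω ⟨y, hy, htop⟩ hσω δ hδ
    refine exists_lt_of_stoppedLiminf_eq_zero (τ := passageTime L (y : ℝ)) hσω ?_ hδ
    rw [← hω y hy]
    have hmem : ω ∉ {ω | passageTime L (y : ℝ) ω < ⊤} := htop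
    rw [Set.indicator_of_notMem hmem]
  · filter_upwards [hZ, hrc, h0, hσ.tendsto_top] with ω hω hrcω h0ω hσω
    refine continuous_runningSup hrcω fun a b ha hab => ?_
    obtain ⟨y, hay, hyb⟩ := exists_rat_btwn hab
    rw [h0ω] at ha
    refine ⟨y, ⟨hay, hyb⟩, fun t ht => ?_⟩
    by_contra! hlt
    have hle := passageTime_le hrcω hlt
    -- A jump over y at t makes t the passage time, where `hω` forces the value y.
    have hτ : passageTime L (y : ℝ) ω = t := by
      refine hle.antisymm (not_lt.1 fun h => ?_)
      obtain ⟨n, hn, hnt⟩ := entryTime_lt_iff.1 h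
      exact (ht _ (WithTop.coe_lt_coe.1 hnt)).not_gt hn.2
    have h1 := hω y (ha.trans_lt hay)
    have hmem : ω ∈ {ω | passageTime L (y : ℝ) ω < ⊤} := hle.trans_lt (WithTop.coe_lt_top t)
    rw [Set.indicator_of_mem hmem, stoppedLiminf_eq hσω hτ] at h1
    exact h1.not_lt (ENNReal.ofReal_lt_ofReal_iff'.2
      ⟨hlt, (one_pos.trans (ha.trans_lt hay)).trans hlt⟩)

/-- If `L` tends to zero and its running supremum is continuous, the level `x` is passed with
probability `1 / x`. -/
theorem mul_measureReal_passageTime_eq [IsProbabilityMeasure P] [𝓕.IsRightContinuous]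
    (hL : StronglyAdapted 𝓕 L)
    (hrc : ∀ᵐ ω ∂P, ∀ t, ContinuousWithinAt (fun s => L s ω) (Set.Ici t) t)
    (hnn : ∀ᵐ ω ∂P, ∀ t, 0 ≤ L t ω) (h0 : ∀ᵐ ω ∂P, L 0 ω = 1)
    (hσ : IsLocalizingSequence 𝓕 σ P) (hM : ∀ n, Martingale (localized L σ n) 𝓕 P)
    (hlim : ∀ᵐ ω ∂P, Tendsto (fun t => L t ω) atTop (𝓝 0))
    (hcont : ∀ᵐ ω ∂P, Continuous fun t => runningSup L t ω) {x : ℝ} (hx : 1 < x) :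
    x * P.real {ω | passageTime L x ω < ⊤} = 1 := by
  have hx0 : 0 < x := one_pos.trans hx
  have hτ := isStoppingTime_passageTime hL x
  have hmeas : MeasurableSet {ω | passageTime L x ω < ⊤} :=
    measurableSet_lt hτ.measurable' measurable_const
  have hbdd : ∀ᵐ ω ∂P, ∀ t : ℝ≥0, (t : WithTop ℝ≥0) ≤ passageTime L x ω → L t ω ≤ x := by
    filter_upwards [hrc, h0, hcont] with ω hω h0ω hc t ht
    refine le_of_continuous_runningSup hc (h0ω.trans_le hx.le) fun u hu => ?_
    by_contra! hlt
    exact hu.not_ge (WithTop.coe_le_coe.1 (ht.trans (passageTime_le hω hlt)))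
  have hX := fun n : ℕ => integral_localized hrc hM hτ n n
  have hlim1 : Tendsto (fun n : ℕ => ∫ ω, localized L σ n (capped n (passageTime L x ω)) ω ∂P)
      atTop (𝓝 (∫ ω, {ω | passageTime L x ω < ⊤}.indicator (fun _ => x) ω ∂P)) := by
    refine tendsto_integral_of_dominated_convergence (fun _ => x)
      (fun n => (hX n).1.aestronglyMeasurable) (integrable_const x) (fun n => ?_) ?_
    · filter_upwards [hbdd, hnn] with ω hω hnnω
      rw [Real.norm_of_nonneg (localized_nonneg hnnω _ _)]
      refine localized_le hx0.le (hω _ ?_)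
      rw [coe_capped, coe_capped]
      exact (min_le_left _ _).trans (min_le_right _ _)
    · filter_upwards [hbdd, hrc, hlim, hσ.tendsto_top] with ω hω hrcω hlimω hσω
      by_cases hfin : passageTime L x ω < ⊤
      · obtain ⟨r, hr⟩ := WithTop.ne_top_iff_exists.1 hfin.ne
        have hval : L r ω = x :=
          le_antisymm (hω r hr.le) (le_of_passageTime_eq hrcω hr.symm)
        rw [Set.indicator_of_mem (show ω ∈ {ω | passageTime L x ω < ⊤} from hfin)]
        refine tendsto_const_nhds.congr' ?_
        filter_upwards [eventually_localized_eq_of_coe (L := L) hσω r] with n hn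
        rw [← hr, hn, hval]
      · rw [Set.indicator_of_notMem (show ω ∉ {ω | passageTime L x ω < ⊤} from hfin)]
        -- If x is never passed, the n-th term is eventually `L` at min(n, σ_n), a time tending to
        -- infinity.
        refine (hlimω.comp (tendsto_capped_localizing hσω)).congr' ?_
        filter_upwards [eventually_localized_eq (L := L) hσω fun n => n] with n hn
        rw [not_lt_top_iff.1 hfin, capped_top, hn, Function.comp_apply]
  -- The localized process vanishes where σ_n = 0, so its initial mean may be below 1 and reaches 1
  -- only in the limit.
  have hlim2 : Tendsto (fun n : ℕ => ∫ ω, localized L σ n 0 ω ∂P) atTop (𝓝 (∫ _, (1 : ℝ) ∂P)) := by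
    refine tendsto_integral_of_dominated_convergence (fun _ => 1)
      (fun n => ((hM n).integrable 0).aestronglyMeasurable) (integrable_const 1) (fun n => ?_) ?_
    · filter_upwards [h0, hnn] with ω hω hnnω
      rw [Real.norm_of_nonneg (localized_nonneg hnnω _ _)]
      refine localized_le zero_le_one ?_
      rw [capped_zero, hω]
    · filter_upwards [h0, hσ.tendsto_top] with ω hω hσω
      refine tendsto_const_nhds.congr' ?_
      filter_upwards [eventually_localized_eq (L := L) hσω fun _ => 0] with n hn
      rw [hn, capped_zero, hω]
  have huniq := tendsto_nhds_unique (hlim1.congr fun n => (hX n).2) hlim2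
  rw [integral_indicator_const _ hmeas, integral_const] at huniq
  simpa [mul_comm] using huniq

end MaximalInequality

end DoobMaximal

theorem lemma2p5 {Ω : Type*} [mΩ : MeasurableSpace Ω] (P : Measure Ω) [IsProbabilityMeasure P]
    (𝓕 : Filtration ℝ≥0 mΩ) (h𝓕 : DoobMaximal.UsualConditions 𝓕 P)
    (L : ℝ≥0 → Ω → ℝ) (hL : DoobMaximal.IsLocalMartingale L 𝓕 P)
    (hL_nonneg : ∀ᵐ ω ∂P, ∀ t, 0 ≤ L t ω) (hL_zero : ∀ᵐ ω ∂P, L 0 ω = 1) :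
    (∀ x : ℝ, 1 < x →
      P {ω | (x : EReal) ≤ DoobMaximal.terminalSup L ω} ≤ ENNReal.ofReal (1 / x)) ∧
    ((∀ x : ℝ, 1 < x →
      P {ω | (x : EReal) ≤ DoobMaximal.terminalSup L ω} = ENNReal.ofReal (1 / x)) ↔
        DoobMaximal.MemM0 L 𝓕 P) := by
  have := h𝓕.rightContinuous
  have hrc : ∀ᵐ ω ∂P, ∀ t, ContinuousWithinAt (fun s => L s ω) (Set.Ici t) t :=
    hL.cadlag.mono fun ω hω t => (hω t).1
  obtain ⟨σ, hσ, hM⟩ := hL.localized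
  have hmax := fun x (hx : (1 : ℝ) < x) =>
    DoobMaximal.measure_le_terminalSup_le hL.adapted hrc hL_nonneg hL_zero hσ hM (one_pos.trans hx)
  refine ⟨hmax, fun heq => ?_, fun h x hx => (hmax x hx).antisymm ?_⟩
  · obtain ⟨hterm, hcont⟩ := DoobMaximal.ae_tendsto_and_continuous_of_measure_eq hL.adapted hrc
      hL_nonneg hL_zero hσ hM heq
    exact ⟨hL, hL_nonneg, hL_zero, hterm, hcont⟩
  · have hpass := DoobMaximal.mul_measureReal_passageTime_eq hL.adapted hrc hL_nonneg hL_zero hσ hM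
      h.terminal h.continuous_runningSup hx
    rw [← eq_one_div_of_mul_eq_one_right hpass, ofReal_measureReal]
    refine measure_mono_ae ?_
    filter_upwards [hrc] with ω hω hlt
    exact ((DoobMaximal.passageTime_lt_top_iff hω).1 hlt).le
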